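/- Let $d\ge 2$ be an integer and $0<\alpha<2$. Let $\mathbb{S}^d$ be the unit sphere in $\mathbb{R}^{d+1}$ with the Euclidean norm $\|\cdot\|$, let $\omega_d$ be its surface area, and let $\sigma_d$ be the normalized (probability) uniform surface area measure on $\mathbb{S}^d$. For $N \ge 1$ and points $x_1,\dots,x_N\in\mathbb{S}^d$ (not necessarily distinct) put $$S_\alpha(x_1,\dots,x_N)=\int_{\mathbb{S}^d}\int_{\mathbb{S}^d}\|x-y\|^\alpha\,d\sigma_d(x)\,d\sigma_d(y)-\frac1{N^2}\sum_{j=1}^N\sum_{k=1}^N\|x_j-x_k\|^\alpha .$$ Then $$\liminf_{N\to\infty}\ \inf_{x_1,\dots,x_N\in\mathbb{S}^d} N^{1+\frac{\alpha}{d}}\,S_\alpha(x_1,\dots,x_N)\ \ge\ c^{\mathrm{asymp}}_{\alpha,d},$$ where $$c^{\mathrm{asymp}}_{\alpha,d}=\frac1{\Gamma(1-\frac\alpha2)}\,\frac1{1+\frac\alpha d}\left(\frac{2\,\Gamma(\frac12)}{\Gamma(\frac{d+1}2)}\right)^{\frac{\alpha}{d}}=(\omega_d)^{\frac{\alpha}{d}}\,\frac1{\Gamma(1-\frac\alpha2)}\,\frac1{1+\frac\alpha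 d}\,\frac1{\pi^{\frac{\alpha}{2}}}.$$ -/

import Mathlib

open MeasureTheory Filter

noncomputable section

/-- The unit sphere `𝕊^d` in the Euclidean space `ℝ^{d+1}`. -/
abbrev UnitSphere (d : ℕ) : Type :=
  Metric.sphere (0 : EuclideanSpace ℝ (Fin (d + 1))) 1

/-- The (unnormalized) surface area measure on `𝕊^d`. -/
def surfaceMeasure (d : ℕ) : Measure (UnitSphere d) :=
  (volume : Measure (EuclideanSpace ℝ (Fin (d + 1)))).toSphere

/-- The surface area `ω_d` of `𝕊^d`. -/
def sphereArea (d : ℕ) : ℝ :=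
  (surfaceMeasure d).real Set.univ

/-- The normalized uniform surface area measure `σ_d` on `𝕊^d`. -/
def uniformSphere (d : ℕ) : Measure (UnitSphere d) :=
  (surfaceMeasure d Set.univ)⁻¹ • surfaceMeasure d

/-- The difference `S_α(x_1, …, x_N)` between the double integral and the normalized double sum of
the `α`-th powers of the Euclidean distances. -/
def distPowerDeficit (α : ℝ) {d N : ℕ} (x : Fin N → UnitSphere d) : ℝ :=
  (∫ y : UnitSphere d, ∫ z : UnitSphere d,
      ‖(y : EuclideanSpace ℝ (Fin (d + 1))) - z‖ ^ α ∂(uniformSphere d) ∂(uniformSphere d))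
    - 1 / (N : ℝ) ^ 2 * ∑ j : Fin N, ∑ k : Fin N,
        ‖(x j : EuclideanSpace ℝ (Fin (d + 1))) - x k‖ ^ α

/-- The constant `c_{α,d}^{asymp}`. -/
def asympConst (α : ℝ) (d : ℕ) : ℝ :=
  1 / Real.Gamma (1 - α / 2) * (1 / (1 + α / d)) *
    (2 * Real.Gamma (1 / 2) / Real.Gamma (((d : ℝ) + 1) / 2)) ^ (α / (d : ℝ))

end

/-! For `0 < α < 2`, the power `r ^ α` is, up to the factor `Γ(1 - α/2) / (α/2)`, the integral over
`t > 0` of `(1 - exp (-t r²)) t^(-α/2 - 1)`. Hence the deficit is a superposition, with positive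
weight `t^(-α/2 - 1)`, of the differences `E(t) - m(t)`. Here `E(t)` is the normalized Gaussian
energy of the points, diagonal included, and `m(t)` is the Gaussian potential of the uniform
measure, which by rotation invariance is constant on the sphere (`distPowerDeficit_eq`).

Two bounds on `E` hold for every configuration: `E(t) ≥ m(t)`, because the Gaussian kernel is
positive definite (`gaussianMean_le_gaussianEnergy`), and `E(t) ≥ 1/N`, from the diagonal alone
(`inv_le_gaussianEnergy`). For large `t` the sphere looks flat, so `m(t) ≤ C t^(-d/2)` for each `C >
π^(d/2) / ω_d` (`eventually_gaussianMean_le`).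

Let `s` solve `C s^(-d/2) = 1/N`. Discarding `t ≤ s` and integrating `1/N - C t^(-d/2)` beyond `s`
gives exactly a constant times `N^(-1 - α/d)`. Since `s → ∞` with `N`, the asymptotic bound on `m`
applies, and letting `C` decrease to `π^(d/2) / ω_d` produces the stated constant. -/

/-! ### The uniform measure on the sphere and its invariance under isometries. -/

instance isFiniteMeasure_surfaceMeasure (d : ℕ) : IsFiniteMeasure (surfaceMeasure d) := by
  unfold surfaceMeasure; infer_instance

lemma surfaceMeasure_ne_zero (d : ℕ) : surfaceMeasure d ≠ 0 := by
  unfold surfaceMeasure; exact Measure.toSphere_ne_zero _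

instance isProbabilityMeasure_uniformSphere (d : ℕ) : IsProbabilityMeasure (uniformSphere d) := by
  have : NeZero (surfaceMeasure d) := ⟨surfaceMeasure_ne_zero d⟩
  unfold uniformSphere; infer_instance

lemma sphereArea_pos (d : ℕ) : 0 < sphereArea d := by
  have : NeZero (surfaceMeasure d) := ⟨surfaceMeasure_ne_zero d⟩
  exact measureReal_univ_pos

/-- The area of the sphere in terms of the Gamma function. -/
lemma sphereArea_eq (d : ℕ) :
    sphereArea d = 2 * Real.pi ^ (((d : ℝ) + 1) / 2) / Real.Gamma (((d : ℝ) + 1) / 2) := by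
  have hpos : (0 : ℝ) < ((d : ℝ) + 1) / 2 := by positivity
  have hpi : √Real.pi ^ (d + 1) = Real.pi ^ (((d : ℝ) + 1) / 2) := by
    rw [Real.sqrt_eq_rpow, ← Real.rpow_natCast, ← Real.rpow_mul Real.pi_pos.le]
    push_cast; ring_nf
  have hG := Real.Gamma_pos_of_pos hpos
  rw [sphereArea, surfaceMeasure, Measure.toSphere_real_apply_univ, measureReal_def,
    EuclideanSpace.volume_ball]
  simp only [ENNReal.ofReal_one, one_pow, one_mul, Fintype.card_fin, finrank_euclideanSpace]
  push_cast
  rw [Real.Gamma_add_one hpos.ne', ENNReal.toReal_ofReal (by positivity), hpi]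
  field_simp

/-- The action of a linear isometry on the unit sphere. -/
noncomputable def sphereMap {d : ℕ} (e : EuclideanSpace ℝ (Fin (d + 1)) ≃ₗᵢ[ℝ] EuclideanSpace ℝ (Fin (d + 1)))
    (x : UnitSphere d) : UnitSphere d :=
  ⟨e x, by simp⟩

lemma continuous_sphereMap {d : ℕ}
    (e : EuclideanSpace ℝ (Fin (d + 1)) ≃ₗᵢ[ℝ] EuclideanSpace ℝ (Fin (d + 1))) :
    Continuous (sphereMap e) :=
  Continuous.subtype_mk (e.continuous.comp continuous_subtype_val) _

-- The surface measure of `s` is a multiple of the Lebesgue measure of the cone `(0, 1) • s`. A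
-- linear isometry commutes with forming cones and preserves Lebesgue measure.
open scoped Pointwise in
lemma measurePreserving_sphereMap_surfaceMeasure {d : ℕ}
    (e : EuclideanSpace ℝ (Fin (d + 1)) ≃ₗᵢ[ℝ] EuclideanSpace ℝ (Fin (d + 1))) :
    MeasurePreserving (sphereMap e) (surfaceMeasure d) (surfaceMeasure d) := by
  refine ⟨(continuous_sphereMap e).measurable, ?_⟩
  ext s hs
  rw [Measure.map_apply (continuous_sphereMap e).measurable hs, surfaceMeasure,
    Measure.toSphere_apply' _ ((continuous_sphereMap e).measurable hs),
    Measure.toSphere_apply' _ hs]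
  congr 1
  have key : Set.Ioo (0 : ℝ) 1 • ((↑) '' (sphereMap e ⁻¹' s) : Set (EuclideanSpace ℝ (Fin (d + 1))))
      = e ⁻¹' (Set.Ioo (0 : ℝ) 1 • ((↑) '' s)) := by
    ext v
    simp only [Set.mem_smul, Set.mem_image, Set.mem_preimage]
    constructor
    · rintro ⟨r, hr, _, ⟨x, hx, rfl⟩, rfl⟩
      exact ⟨r, hr, _, ⟨_, hx, rfl⟩, by simp [sphereMap]⟩
    · rintro ⟨r, hr, _, ⟨x, hx, rfl⟩, hv⟩
      refine ⟨r, hr, _, ⟨sphereMap e.symm x, ?_, rfl⟩, ?_⟩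
      · convert hx
        ext1
        simp [sphereMap]
      · apply e.injective
        simp [sphereMap, hv]
  rw [key]
  exact e.measurePreserving.measure_preimage_equiv (f := e.toMeasurableEquiv) _

lemma measurePreserving_sphereMap {d : ℕ}
    (e : EuclideanSpace ℝ (Fin (d + 1)) ≃ₗᵢ[ℝ] EuclideanSpace ℝ (Fin (d + 1))) :
    MeasurePreserving (sphereMap e) (uniformSphere d) (uniformSphere d) := by
  unfold uniformSphere
  exact (measurePreserving_sphereMap_surfaceMeasure e).smul_measure _

/-- The potential of the uniform measure for a radial kernel is constant on the sphere. -/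
lemma integral_radial_eq {d : ℕ} {F : ℝ → ℝ} (hF : Continuous F) (p q : UnitSphere d) :
    ∫ z : UnitSphere d, F ‖(p : EuclideanSpace ℝ (Fin (d + 1))) - z‖ ∂(uniformSphere d) =
      ∫ z : UnitSphere d, F ‖(q : EuclideanSpace ℝ (Fin (d + 1))) - z‖ ∂(uniformSphere d) := by
  -- Reflection in the hyperplane orthogonal to `p - q` carries `p` to `q`, as both have norm 1.
  set e := (Submodule.span ℝ {(p : EuclideanSpace ℝ (Fin (d + 1))) - q})ᗮ.reflection
  have he : e p = q := Submodule.reflection_sub (by simp)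
  have h := measurePreserving_sphereMap e
  have hc : Continuous fun z : UnitSphere d ↦ F ‖(q : EuclideanSpace ℝ (Fin (d + 1))) - z‖ := by
    fun_prop
  conv_rhs => rw [← h.map_eq]
  rw [integral_map h.measurable.aemeasurable hc.aestronglyMeasurable]
  congr 1 with z
  congr 1
  rw [← he]
  simp only [sphereMap]
  rw [← map_sub, e.norm_map]

/-! ### Positive definiteness of the Gaussian kernel. -/

lemma ENNReal.two_mul_mul_le_add_mul_self (a b : ENNReal) : 2 * (a * b) ≤ a * a + b * b := by
  induction a with
  | top => simp
  | coe a =>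
    induction b with
    | top => simp
    | coe b =>
      have h : 2 * (a * b) ≤ a * a + b * b := by
        rw [← NNReal.coe_le_coe]
        push_cast
        nlinarith [sq_nonneg ((a : ℝ) - b)]
      exact_mod_cast h

section Gaussian

variable {V : Type*} [NormedAddCommGroup V] [InnerProductSpace ℝ V] [FiniteDimensional ℝ V]
  [MeasurableSpace V] [BorelSpace V]

lemma lintegral_exp_neg_mul_sq_norm_sub {b : ℝ} (hb : 0 < b) (c : V) :
    ∫⁻ z : V, ENNReal.ofReal (Real.exp (-b * ‖z - c‖ ^ 2)) =
      ENNReal.ofReal ((Real.pi / b) ^ (Module.finrank ℝ V / 2 : ℝ)) := by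
  have h0 := GaussianFourier.integral_rexp_neg_mul_sq_norm (V := V) hb
  have hi : Integrable fun z : V ↦ Real.exp (-b * ‖z‖ ^ 2) := by
    -- A non-integrable function would have Bochner integral 0, but the known value is positive.
    by_contra h
    rw [integral_undef h] at h0
    exact (by positivity : (Real.pi / b) ^ (Module.finrank ℝ V / 2 : ℝ) ≠ 0) h0.symm
  rw [lintegral_sub_right_eq_self (fun z : V ↦ ENNReal.ofReal (Real.exp (-b * ‖z‖ ^ 2))) c, ← h0,
    ofReal_integral_eq_lintegral_ofReal hi (Eventually.of_forall fun _ ↦ (Real.exp_pos _).le)]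

/-- A Gaussian kernel is a convolution square of a Gaussian. -/
lemma lintegral_gaussian_mul_gaussian {t : ℝ} (ht : 0 < t) (x y : V) :
    ∫⁻ z : V, ENNReal.ofReal (Real.exp (-(2 * t) * ‖x - z‖ ^ 2)) *
        ENNReal.ofReal (Real.exp (-(2 * t) * ‖y - z‖ ^ 2)) =
      ENNReal.ofReal (Real.exp (-t * ‖x - y‖ ^ 2)) *
        ENNReal.ofReal ((Real.pi / (4 * t)) ^ (Module.finrank ℝ V / 2 : ℝ)) := by
  rw [← lintegral_exp_neg_mul_sq_norm_sub (by positivity : 0 < 4 * t) ((1 / 2 : ℝ) • (x + y)),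
    ← lintegral_const_mul' _ _ ENNReal.ofReal_ne_top]
  congr 1 with z
  rw [← ENNReal.ofReal_mul (Real.exp_pos _).le, ← ENNReal.ofReal_mul (Real.exp_pos _).le,
    ← Real.exp_add, ← Real.exp_add]
  congr 2
  -- Completing the square about the midpoint: `2 (‖x - z‖² + ‖y - z‖²) = ‖x - y‖² + 4 ‖z - (x +
  -- y)/2‖²`.
  have h := parallelogram_law_with_norm ℝ (x - z) (y - z)
  have h1 : x - z - (y - z) = x - y := by abel
  have h2 : x - z + (y - z) = (-2 : ℝ) • (z - (1 / 2 : ℝ) • (x + y)) := by module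
  rw [h1, h2, norm_smul, Real.norm_eq_abs, abs_neg, abs_two] at h
  linear_combination t * h

variable {X : Type*} [MeasurableSpace X]

/-- Tonelli turns the convolution-square identity into an `L²` pairing: up to a positive constant,
the mutual energy of `μ` and `ν` is the integral of the product of their Gaussian smoothings.
Positive definiteness then reduces to `2ab ≤ a² + b²` pointwise. -/
lemma lintegral_lintegral_gaussian {f : X → V} (hf : Measurable f) {t : ℝ} (ht : 0 < t)
    (μ ν : Measure X) [SFinite μ] [SFinite ν] :
    ∫⁻ z : V, (∫⁻ x, ENNReal.ofReal (Real.exp (-(2 * t) * ‖f x - z‖ ^ 2)) ∂μ) *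
        ∫⁻ y, ENNReal.ofReal (Real.exp (-(2 * t) * ‖f y - z‖ ^ 2)) ∂ν =
      (∫⁻ x, ∫⁻ y, ENNReal.ofReal (Real.exp (-t * ‖f x - f y‖ ^ 2)) ∂ν ∂μ) *
        ENNReal.ofReal ((Real.pi / (4 * t)) ^ (Module.finrank ℝ V / 2 : ℝ)) := by
  have hg : Measurable fun q : X × V ↦ ENNReal.ofReal (Real.exp (-(2 * t) * ‖f q.1 - q.2‖ ^ 2)) := by
    fun_prop
  have hA (ρ : Measure X) [SFinite ρ] : Measurable fun z : V ↦
      ∫⁻ x, ENNReal.ofReal (Real.exp (-(2 * t) * ‖f x - z‖ ^ 2)) ∂ρ := hg.lintegral_prod_left'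
  rw [← lintegral_mul_const' _ _ ENNReal.ofReal_ne_top]
  calc _ = ∫⁻ z : V, ∫⁻ x, ∫⁻ y, ENNReal.ofReal (Real.exp (-(2 * t) * ‖f x - z‖ ^ 2)) *
        ENNReal.ofReal (Real.exp (-(2 * t) * ‖f y - z‖ ^ 2)) ∂ν ∂μ := by
        congr 1 with z
        rw [← lintegral_mul_const _ (by fun_prop)]
        congr 1 with x
        rw [lintegral_const_mul _ (by fun_prop)]
    _ = ∫⁻ x, (∫⁻ z : V, ∫⁻ y, ENNReal.ofReal (Real.exp (-(2 * t) * ‖f x - z‖ ^ 2)) *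
        ENNReal.ofReal (Real.exp (-(2 * t) * ‖f y - z‖ ^ 2)) ∂ν) ∂μ := by
        have hm : Measurable fun q : (V × X) × X ↦
            ENNReal.ofReal (Real.exp (-(2 * t) * ‖f q.1.2 - q.1.1‖ ^ 2)) *
            ENNReal.ofReal (Real.exp (-(2 * t) * ‖f q.2 - q.1.1‖ ^ 2)) := by fun_prop
        exact lintegral_lintegral_swap (hm.lintegral_prod_right' (ν := ν)).aemeasurable
    _ = _ := by
        congr 1 with x
        rw [lintegral_lintegral_swap (by fun_prop), ← lintegral_mul_const' _ _ ENNReal.ofReal_ne_top]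
        congr 1 with y
        exact lintegral_gaussian_mul_gaussian ht _ _

/-- The Gaussian kernel is positive definite. -/
lemma gaussian_energy_le {f : X → V} (hf : Measurable f) {t : ℝ} (ht : 0 < t)
    (μ ν : Measure X) [SFinite μ] [SFinite ν] :
    2 * ∫⁻ x, ∫⁻ y, ENNReal.ofReal (Real.exp (-t * ‖f x - f y‖ ^ 2)) ∂ν ∂μ ≤
      (∫⁻ x, ∫⁻ y, ENNReal.ofReal (Real.exp (-t * ‖f x - f y‖ ^ 2)) ∂μ ∂μ) +
      ∫⁻ x, ∫⁻ y, ENNReal.ofReal (Real.exp (-t * ‖f x - f y‖ ^ 2)) ∂ν ∂ν := by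
  have hK : ENNReal.ofReal ((Real.pi / (4 * t)) ^ (Module.finrank ℝ V / 2 : ℝ)) ≠ 0 := by
    rw [ne_eq, ENNReal.ofReal_eq_zero, not_le]; positivity
  rw [← ENNReal.mul_le_mul_iff_left hK ENNReal.ofReal_ne_top, add_mul, mul_assoc,
    ← lintegral_lintegral_gaussian hf ht, ← lintegral_lintegral_gaussian hf ht,
    ← lintegral_lintegral_gaussian hf ht]
  have hg : Measurable fun q : X × V ↦ ENNReal.ofReal (Real.exp (-(2 * t) * ‖f q.1 - q.2‖ ^ 2)) := by
    fun_prop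
  have hA (ρ : Measure X) [SFinite ρ] : Measurable fun z : V ↦
      ∫⁻ x, ENNReal.ofReal (Real.exp (-(2 * t) * ‖f x - z‖ ^ 2)) ∂ρ := hg.lintegral_prod_left'
  have h1 := lintegral_const_mul (μ := (volume : Measure V)) 2 ((hA μ).mul (hA ν))
  have h2 := lintegral_add_left (μ := (volume : Measure V)) ((hA μ).mul (hA μ))
    ((fun z : V ↦ ∫⁻ x, ENNReal.ofReal (Real.exp (-(2 * t) * ‖f x - z‖ ^ 2)) ∂ν) *
      fun z : V ↦ ∫⁻ x, ENNReal.ofReal (Real.exp (-(2 * t) * ‖f x - z‖ ^ 2)) ∂ν)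
  simp only [Pi.mul_apply] at h1 h2
  rw [← h1, ← h2]
  exact lintegral_mono fun z ↦ ENNReal.two_mul_mul_le_add_mul_self _ _

end Gaussian

/-! ### Gaussian potential of the sphere and Gaussian energy of a configuration. -/

/-- The potential of the uniform measure on the sphere for the kernel `exp (-t ‖x - y‖ ^ 2)`. -/
noncomputable def gaussianMean (d : ℕ) (p : UnitSphere d) (t : ℝ) : ℝ :=
  ∫ z : UnitSphere d, Real.exp (-t * ‖(p : EuclideanSpace ℝ (Fin (d + 1))) - z‖ ^ 2)
    ∂(uniformSphere d)

lemma gaussianMean_eq {d : ℕ} (p q : UnitSphere d) (t : ℝ) :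
    gaussianMean d p t = gaussianMean d q t :=
  integral_radial_eq (F := fun r ↦ Real.exp (-t * r ^ 2)) (by fun_prop) p q

lemma integrable_of_continuous_unitSphere {d : ℕ} {f : UnitSphere d → ℝ} (hf : Continuous f) :
    Integrable f (uniformSphere d) := by
  rw [← integrableOn_univ]
  exact hf.continuousOn.integrableOn_compact isCompact_univ

lemma ofReal_gaussianMean {d : ℕ} (p : UnitSphere d) (t : ℝ) :
    ENNReal.ofReal (gaussianMean d p t) = ∫⁻ z : UnitSphere d, ENNReal.ofReal
      (Real.exp (-t * ‖(p : EuclideanSpace ℝ (Fin (d + 1))) - z‖ ^ 2)) ∂(uniformSphere d) :=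
  ofReal_integral_eq_lintegral_ofReal (integrable_of_continuous_unitSphere (by fun_prop))
    (Eventually.of_forall fun _ ↦ (Real.exp_pos _).le)

/-- The normalized Gaussian energy of a point configuration. -/
noncomputable def gaussianEnergy {d N : ℕ} (x : Fin N → UnitSphere d) (t : ℝ) : ℝ :=
  1 / (N : ℝ) ^ 2 * ∑ j, ∑ k, Real.exp (-t * ‖(x j : EuclideanSpace ℝ (Fin (d + 1))) - x k‖ ^ 2)

/-- Positive definiteness is applied to the sum of the point masses and to `N` times the uniform
measure. Because the uniform potential is constant, the mixed energy and the uniform self-energy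
both equal `N²` times the mean, so one copy cancels. -/
lemma gaussianMean_le_gaussianEnergy {d N : ℕ} (hN : N ≠ 0) (x : Fin N → UnitSphere d)
    (p : UnitSphere d) {t : ℝ} (ht : 0 < t) : gaussianMean d p t ≤ gaussianEnergy x t := by
  set μ : Measure (UnitSphere d) := ∑ j, Measure.dirac (x j)
  have hμ (f : UnitSphere d → ENNReal) (hf : Measurable f) : ∫⁻ y, f y ∂μ = ∑ j, f (x j) := by
    simp [μ, lintegral_finsetSum_measure, lintegral_dirac' _ hf]
  have h := gaussian_energy_le (V := EuclideanSpace ℝ (Fin (d + 1)))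
    (f := fun y : UnitSphere d ↦ (y : EuclideanSpace ℝ (Fin (d + 1)))) measurable_subtype_coe ht
    μ ((N : NNReal) • uniformSphere d)
  have hE (y : UnitSphere d) : Measurable fun z : UnitSphere d ↦ ENNReal.ofReal
      (Real.exp (-t * ‖(y : EuclideanSpace ℝ (Fin (d + 1))) - z‖ ^ 2)) := by fun_prop
  have hM : Measurable fun y : UnitSphere d ↦ ∫⁻ z, ENNReal.ofReal
      (Real.exp (-t * ‖(y : EuclideanSpace ℝ (Fin (d + 1))) - z‖ ^ 2)) ∂μ := by
    simp only [hμ _ (hE _)]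
    fun_prop
  have hI : 0 ≤ gaussianMean d p t := integral_nonneg fun _ ↦ (Real.exp_pos _).le
  have h1 : ∫⁻ y : UnitSphere d, ∫⁻ z, ENNReal.ofReal
      (Real.exp (-t * ‖(y : EuclideanSpace ℝ (Fin (d + 1))) - z‖ ^ 2))
        ∂((N : NNReal) • uniformSphere d) ∂μ = ENNReal.ofReal (N * (N * gaussianMean d p t)) := by
    simp only [lintegral_smul_measure, ← ofReal_gaussianMean, gaussianMean_eq _ p]
    rw [hμ _ measurable_const, ENNReal.ofReal_mul (by positivity),
      ENNReal.ofReal_mul (by positivity)]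
    simp [ENNReal.smul_def]
  have h2 : ∫⁻ y : UnitSphere d, ∫⁻ z, ENNReal.ofReal
      (Real.exp (-t * ‖(y : EuclideanSpace ℝ (Fin (d + 1))) - z‖ ^ 2))
        ∂((N : NNReal) • uniformSphere d) ∂((N : NNReal) • uniformSphere d) =
          ENNReal.ofReal (N * (N * gaussianMean d p t)) := by
    simp only [lintegral_smul_measure, ← ofReal_gaussianMean, gaussianMean_eq _ p]
    rw [lintegral_const, measure_univ, mul_one, ENNReal.ofReal_mul (by positivity),
      ENNReal.ofReal_mul (by positivity)]
    simp [ENNReal.smul_def]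
  have h3 : ∫⁻ y : UnitSphere d, ∫⁻ z, ENNReal.ofReal
      (Real.exp (-t * ‖(y : EuclideanSpace ℝ (Fin (d + 1))) - z‖ ^ 2)) ∂μ ∂μ = ENNReal.ofReal
        (∑ j, ∑ k, Real.exp (-t * ‖(x j : EuclideanSpace ℝ (Fin (d + 1))) - x k‖ ^ 2)) := by
    rw [hμ _ hM, ENNReal.ofReal_sum_of_nonneg fun _ _ ↦ by positivity]
    refine Finset.sum_congr rfl fun j _ ↦ ?_
    rw [hμ _ (hE _), ENNReal.ofReal_sum_of_nonneg fun _ _ ↦ by positivity]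
  rw [h1, h2, h3, ← ENNReal.ofReal_add (by positivity) (by positivity), two_mul,
    ← ENNReal.ofReal_add (by positivity) (by positivity),
    ENNReal.ofReal_le_ofReal_iff (by positivity)] at h
  have hN' : (0 : ℝ) < N := by positivity
  rw [gaussianEnergy, one_div, inv_mul_eq_div, le_div_iff₀ (by positivity)]
  linarith

/-- The `N` diagonal terms each equal 1 and all other terms are nonnegative. -/
lemma inv_le_gaussianEnergy {d N : ℕ} (x : Fin N → UnitSphere d) (t : ℝ) :
    1 / (N : ℝ) ≤ gaussianEnergy x t := by
  have h : (N : ℝ) ≤ ∑ j, ∑ k,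
      Real.exp (-t * ‖(x j : EuclideanSpace ℝ (Fin (d + 1))) - x k‖ ^ 2) := by
    calc (N : ℝ) = ∑ j : Fin N, 1 := by simp
      _ ≤ _ := Finset.sum_le_sum fun j _ ↦ by
        have := Finset.single_le_sum (f := fun k ↦
          Real.exp (-t * ‖(x j : EuclideanSpace ℝ (Fin (d + 1))) - x k‖ ^ 2))
          (fun k _ ↦ (Real.exp_pos _).le) (Finset.mem_univ j)
        simpa using this
  unfold gaussianEnergy
  rcases eq_or_ne (N : ℝ) 0 with h0 | h0
  · simp [h0]
  · calc 1 / (N : ℝ) = 1 / (N : ℝ) ^ 2 * N := by field_simp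
      _ ≤ _ := by gcongr

/-! ### Powers as superpositions of Gaussians. -/

section PowerRepresentation

open Set Real Topology

lemma abs_one_sub_exp_neg_le {x : ℝ} (hx : 0 ≤ x) : |1 - exp (-x)| ≤ x := by
  rw [abs_of_nonneg (by simpa using hx)]
  linarith [add_one_le_exp (-x)]

lemma abs_one_sub_exp_neg_le_one {x : ℝ} (hx : 0 ≤ x) : |1 - exp (-x)| ≤ 1 := by
  rw [abs_of_nonneg (by simpa using hx)]
  linarith [exp_pos (-x)]

variable {a u : ℝ}

/-- Near 0 the integrand is dominated by `u t^(-a)`, integrable since `a < 1`; beyond 1 it is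
dominated by `t^(-a - 1)`, integrable since `a > 0`. -/
lemma integrableOn_one_sub_exp_mul_rpow (ha0 : 0 < a) (ha1 : a < 1) (hu : 0 ≤ u) :
    IntegrableOn (fun t ↦ (1 - exp (-(u * t))) * t ^ (-a - 1)) (Ioi 0) := by
  have hm (s : Set ℝ) : AEStronglyMeasurable (fun t : ℝ ↦ (1 - exp (-(u * t))) * t ^ (-a - 1))
      (volume.restrict s) := by
    apply Measurable.aestronglyMeasurable; fun_prop
  rw [← Ioc_union_Ioi_eq_Ioi zero_le_one]
  refine IntegrableOn.union ?_ ?_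
  · have h : IntegrableOn (fun t : ℝ ↦ u * t ^ (-a)) (Ioc 0 1) := by
      rw [← intervalIntegrable_iff_integrableOn_Ioc_of_le zero_le_one]
      exact (intervalIntegral.intervalIntegrable_rpow' (by linarith)).const_mul _
    refine h.mono' (hm _) ?_
    filter_upwards [ae_restrict_mem measurableSet_Ioc] with t ht
    have hp : 0 < t ^ (-a - 1) := rpow_pos_of_pos ht.1 _
    rw [norm_mul, norm_of_nonneg hp.le, norm_eq_abs]
    calc _ ≤ u * t * t ^ (-a - 1) := by
          gcongr; exact abs_one_sub_exp_neg_le (mul_nonneg hu ht.1.le)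
      _ = u * t ^ (-a) := by
          rw [mul_assoc, rpow_sub_one ht.1.ne', mul_div_cancel₀ _ ht.1.ne']
  · refine (integrableOn_Ioi_rpow_of_lt (by linarith : -a - 1 < -1) one_pos).mono' (hm _) ?_
    filter_upwards [ae_restrict_mem measurableSet_Ioi] with t ht
    have ht0 : 0 < t := one_pos.trans ht
    have hp : 0 < t ^ (-a - 1) := rpow_pos_of_pos ht0 _
    rw [norm_mul, norm_of_nonneg hp.le, norm_eq_abs]
    exact mul_le_of_le_one_left hp.le (abs_one_sub_exp_neg_le_one (by positivity))

lemma integral_one_sub_exp_mul_rpow (ha0 : 0 < a) (ha1 : a < 1) (hu : 0 ≤ u) :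
    ∫ t in Ioi 0, (1 - exp (-(u * t))) * t ^ (-a - 1) = Gamma (1 - a) / a * u ^ a := by
  rcases hu.eq_or_lt with rfl | hu0
  · simp [zero_rpow ha0.ne']
  have hga := Real.integral_rpow_mul_exp_neg_mul_Ioi (by linarith : 0 < 1 - a) hu0
  have hgi : IntegrableOn (fun t ↦ t ^ (1 - a - 1) * exp (-(u * t))) (Ioi 0) := by
    by_contra h
    rw [integral_undef h] at hga
    exact (mul_pos (rpow_pos_of_pos (by positivity) _) (Gamma_pos_of_pos (by linarith))).ne hga
  -- Integration by parts, with both boundary terms zero, leaves the Gamma integral of exponent `1 -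
  -- a`.
  have h := integral_Ioi_mul_deriv_eq_deriv_mul (a := 0) (a' := 0) (b' := 0)
    (u := fun t ↦ 1 - exp (-(u * t))) (u' := fun t ↦ u * exp (-(u * t)))
    (v := fun t ↦ -(1 / a) * t ^ (-a)) (v' := fun t ↦ t ^ (-a - 1)) ?_ ?_ ?_ ?_ ?_ ?_
  · rw [h]
    have : ∀ t : ℝ, u * exp (-(u * t)) * (-(1 / a) * t ^ (-a)) =
        -(u / a) * (t ^ (1 - a - 1) * exp (-(u * t))) := fun t ↦ by
      rw [show 1 - a - 1 = -a by ring]; ring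
    simp_rw [this]
    rw [integral_const_mul, hga, one_div, inv_rpow hu, ← rpow_neg hu, neg_sub,
      rpow_sub_one hu0.ne']
    field_simp
    ring
  · intro t _
    have := ((hasDerivAt_id t).const_mul u).neg.exp.const_sub 1
    simpa [mul_comm] using this
  · intro t ht
    have := (hasDerivAt_rpow_const (p := -a) (Or.inl (ne_of_gt ht))).const_mul (-(1 / a))
    convert this using 1
    field_simp
  · exact integrableOn_one_sub_exp_mul_rpow ha0 ha1 hu
  · refine (hgi.const_mul (-(u / a))).congr (Eventually.of_forall fun t ↦ ?_)
    simp only [Pi.mul_apply]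
    rw [show 1 - a - 1 = -a by ring]; ring
  · have h0 : Tendsto (fun t : ℝ ↦ u / a * t ^ (1 - a)) (𝓝[>] 0) (𝓝 0) := by
      have : Tendsto (fun t : ℝ ↦ u / a * t ^ (1 - a)) (𝓝 0) (𝓝 (u / a * 0 ^ (1 - a))) :=
        ((continuousAt_rpow_const 0 (1 - a) (Or.inr (by linarith))).tendsto).const_mul _
      rw [zero_rpow (by linarith), mul_zero] at this
      exact this.mono_left nhdsWithin_le_nhds
    refine squeeze_zero_norm' ?_ h0
    filter_upwards [self_mem_nhdsWithin] with t (ht : 0 < t)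
    have hp : 0 < t ^ (-a) := rpow_pos_of_pos ht _
    simp only [Pi.mul_apply, norm_mul, norm_eq_abs, abs_neg, abs_of_pos hp,
      abs_of_pos (one_div_pos.2 ha0)]
    calc _ ≤ u * t * (1 / a * t ^ (-a)) := by
          gcongr; exact abs_one_sub_exp_neg_le (by positivity)
      _ = u / a * t ^ (1 - a) := by
          rw [show 1 - a = -a + 1 by ring, rpow_add_one ht.ne']; ring
  · have h0 : Tendsto (fun t : ℝ ↦ 1 / a * t ^ (-a)) atTop (𝓝 0) := by
      simpa using (tendsto_rpow_neg_atTop ha0).const_mul (1 / a)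
    refine squeeze_zero_norm' ?_ h0
    filter_upwards [eventually_gt_atTop 0] with t ht
    have hp : 0 < t ^ (-a) := rpow_pos_of_pos ht _
    simp only [Pi.mul_apply, norm_mul, norm_eq_abs, abs_neg, abs_of_pos hp,
      abs_of_pos (one_div_pos.2 ha0)]
    exact mul_le_of_le_one_left (by positivity) (abs_one_sub_exp_neg_le_one (by positivity))

/-- The power `r ^ α` as a superposition of the functions `1 - exp (-t r ^ 2)`. -/
lemma integral_one_sub_exp_mul_sq_mul_rpow {α : ℝ} (hα0 : 0 < α) (hα2 : α < 2) {r : ℝ}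
    (hr : 0 ≤ r) :
    ∫ t in Ioi 0, (1 - exp (-t * r ^ 2)) * t ^ (-(α / 2) - 1) =
      Gamma (1 - α / 2) / (α / 2) * r ^ α := by
  have h := integral_one_sub_exp_mul_rpow (a := α / 2) (by linarith) (by linarith) (sq_nonneg r)
  have hpow : (r ^ 2) ^ (α / 2) = r ^ α := by
    rw [← rpow_natCast r 2, ← rpow_mul hr]
    congr 1
    push_cast
    ring
  rw [hpow] at h
  convert h using 6
  ring

lemma integrableOn_one_sub_exp_mul_sq_mul_rpow {α : ℝ} (hα0 : 0 < α) (hα2 : α < 2) (r : ℝ) :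
    IntegrableOn (fun t ↦ (1 - exp (-t * r ^ 2)) * t ^ (-(α / 2) - 1)) (Ioi 0) := by
  have h := integrableOn_one_sub_exp_mul_rpow (a := α / 2) (by linarith) (by linarith) (sq_nonneg r)
  convert h using 5
  ring

end PowerRepresentation

/-! ### Asymptotic upper bound for the Gaussian potential of the sphere. -/

/-- Integration in polar coordinates. -/
lemma lintegral_polar (d : ℕ) {f : EuclideanSpace ℝ (Fin (d + 1)) → ENNReal} (hf : Measurable f) :
    ∫⁻ v, f v = ∫⁻ r in Set.Ioi (0 : ℝ), ENNReal.ofReal (r ^ d) *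
      ∫⁻ x : UnitSphere d, f (r • (x : EuclideanSpace ℝ (Fin (d + 1)))) ∂(surfaceMeasure d) := by
  have hmp := (volume : Measure (EuclideanSpace ℝ (Fin (d + 1)))).measurePreserving_homeomorphUnitSphereProd
  have hg : Measurable fun q : UnitSphere d × Set.Ioi (0 : ℝ) ↦
      f (q.2.1 • (q.1 : EuclideanSpace ℝ (Fin (d + 1)))) := hf.comp (by fun_prop)
  have hinner : Measurable fun r : Set.Ioi (0 : ℝ) ↦
      ∫⁻ x : UnitSphere d, f (r.1 • (x : EuclideanSpace ℝ (Fin (d + 1)))) ∂(surfaceMeasure d) :=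
    hg.lintegral_prod_left'
  have h1 := hmp.lintegral_comp hg
  calc ∫⁻ v, f v = ∫⁻ v in ({0}ᶜ : Set (EuclideanSpace ℝ (Fin (d + 1)))), f v := by
        rw [restrict_compl_singleton]
    _ = ∫⁻ v : ({0}ᶜ : Set (EuclideanSpace ℝ (Fin (d + 1)))), f v ∂(volume.comap Subtype.val) :=
        (lintegral_subtype_comap (measurableSet_singleton _).compl f).symm
    _ = ∫⁻ q : UnitSphere d × Set.Ioi (0 : ℝ), f (q.2.1 • (q.1 : EuclideanSpace ℝ (Fin (d + 1))))
          ∂((surfaceMeasure d).prod (Measure.volumeIoiPow d)) := by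
        simp only [finrank_euclideanSpace, Fintype.card_fin, Nat.add_sub_cancel] at h1
        rw [surfaceMeasure, ← h1]
        congr 1 with v
        have hv : ‖(v : EuclideanSpace ℝ (Fin (d + 1)))‖ ≠ 0 := norm_ne_zero_iff.2 v.2
        simp [smul_smul, hv]
    _ = ∫⁻ r : Set.Ioi (0 : ℝ), (∫⁻ x : UnitSphere d,
          f (r.1 • (x : EuclideanSpace ℝ (Fin (d + 1)))) ∂(surfaceMeasure d))
            ∂(Measure.volumeIoiPow d) := lintegral_prod_symm' _ hg
    _ = _ := by
        rw [Measure.volumeIoiPow, lintegral_withDensity_eq_lintegral_mul _ (by fun_prop) hinner]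
        exact lintegral_subtype_comap measurableSet_Ioi fun r : ℝ ↦ ENNReal.ofReal (r ^ d) *
          ∫⁻ x : UnitSphere d, f (r • (x : EuclideanSpace ℝ (Fin (d + 1)))) ∂(surfaceMeasure d)

lemma surfaceMeasure_eq_smul (d : ℕ) :
    surfaceMeasure d = ENNReal.ofReal (sphereArea d) • uniformSphere d := by
  have h0 : surfaceMeasure d Set.univ ≠ 0 := by simpa using surfaceMeasure_ne_zero d
  rw [sphereArea, ofReal_measureReal, uniformSphere, smul_smul,
    ENNReal.mul_inv_cancel h0 (measure_ne_top _ _), one_smul]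

/-- This splits the Gaussian centred at `p` into a radial factor `exp (-t (r - 1)²)` and a Gaussian
on the unit sphere with parameter `t r`. -/
lemma norm_smul_sub_sq_of_mem_sphere {d : ℕ} (p x : UnitSphere d) (r : ℝ) :
    ‖r • (x : EuclideanSpace ℝ (Fin (d + 1))) - p‖ ^ 2 =
      (r - 1) ^ 2 + r * ‖(p : EuclideanSpace ℝ (Fin (d + 1))) - x‖ ^ 2 := by
  rw [norm_sub_sq_real, norm_sub_sq_real, norm_smul, inner_smul_left, real_inner_comm]
  simp only [norm_eq_of_mem_sphere, Real.norm_eq_abs, mul_one, sq_abs, conj_trivial]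
  ring

lemma gaussianMean_antitone {d : ℕ} (p : UnitSphere d) : Antitone (gaussianMean d p) := by
  intro s t hst
  refine integral_mono (integrable_of_continuous_unitSphere (by fun_prop))
    (integrable_of_continuous_unitSphere (by fun_prop)) fun z ↦ ?_
  simp only
  gcongr

lemma gaussianMean_nonneg {d : ℕ} (p : UnitSphere d) (t : ℝ) : 0 ≤ gaussianMean d p t :=
  integral_nonneg fun _ ↦ (Real.exp_pos _).le

/-- A lower bound for the mass of a Gaussian on a bounded interval. -/
lemma gaussian_interval_lower_bound {t δ : ℝ} (ht : 0 < t) (hδ : 0 < δ) :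
    √(Real.pi / t) * (1 - √2 * Real.exp (-(t * δ ^ 2 / 2))) ≤
      ∫ r in Set.Ioo (1 - δ) (1 + δ), Real.exp (-t * (r - 1) ^ 2) := by
  have hi (b : ℝ) (hb : 0 < b) : Integrable fun r : ℝ ↦ Real.exp (-b * (r - 1) ^ 2) :=
    (integrable_exp_neg_mul_sq hb).comp_sub_right 1
  have hv (b : ℝ) : ∫ r : ℝ, Real.exp (-b * (r - 1) ^ 2) = √(Real.pi / b) := by
    rw [integral_sub_right_eq_self (fun r : ℝ ↦ Real.exp (-b * r ^ 2)) 1, integral_gaussian]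
  have ht2 : 0 < t / 2 := by positivity
  -- Off the interval, half of the exponent already exceeds `t δ² / 2`, so the tail is at most `exp
  -- (-t δ² / 2)` times the Gaussian with parameter `t / 2`, whose total mass is `√2` times larger.
  calc √(Real.pi / t) * (1 - √2 * Real.exp (-(t * δ ^ 2 / 2)))
      = ∫ r : ℝ, (Real.exp (-t * (r - 1) ^ 2) -
          Real.exp (-(t * δ ^ 2 / 2)) * Real.exp (-(t / 2) * (r - 1) ^ 2)) := by
        rw [integral_sub (hi t ht) ((hi _ ht2).const_mul _), integral_const_mul, hv, hv]
        have : √(Real.pi / (t / 2)) = √(Real.pi / t) * √2 := by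
          rw [← Real.sqrt_mul (by positivity)]; congr 1; field_simp
        rw [this]; ring
    _ ≤ ∫ r : ℝ, (Set.Ioo (1 - δ) (1 + δ)).indicator (fun r ↦ Real.exp (-t * (r - 1) ^ 2)) r := by
        refine integral_mono ((hi t ht).sub ((hi _ ht2).const_mul _))
          ((hi t ht).indicator measurableSet_Ioo) fun r ↦ ?_
        by_cases hr : r ∈ Set.Ioo (1 - δ) (1 + δ)
        · simp only [Set.indicator_of_mem hr, sub_le_self_iff]
          positivity
        · simp only [Set.indicator_of_notMem hr, sub_nonpos]
          rw [← Real.exp_add, Real.exp_le_exp]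
          have : δ ^ 2 ≤ (r - 1) ^ 2 := by
            rw [sq_le_sq, abs_of_pos hδ, le_abs]
            by_contra! h
            exact hr ⟨by linarith, by linarith⟩
          nlinarith
    _ = _ := integral_indicator measurableSet_Ioo

/-- The Gaussian centred at `p` has mass `(π / t)^((d + 1)/2)` in the ambient space. In polar
coordinates the shell `|r - 1| < δ` contributes at most that much; cancelling the radial factor `√(π
/ t)` leaves the exponent `d / 2`. -/
lemma gaussianMean_upper_bound {d : ℕ} (p : UnitSphere d) {t δ : ℝ} (ht : 0 < t) (hδ : 0 < δ)
    (hδ1 : δ < 1) :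
    gaussianMean d p ((1 + δ) * t) *
        ((1 - δ) ^ d * sphereArea d * (1 - √2 * Real.exp (-(t * δ ^ 2 / 2)))) ≤
      (Real.pi / t) ^ ((d : ℝ) / 2) := by
  set A := gaussianMean d p ((1 + δ) * t) with hA
  have hA0 : 0 ≤ A := gaussianMean_nonneg _ _
  have hω := sphereArea_pos d
  have hi : IntegrableOn (fun r : ℝ ↦ Real.exp (-t * (r - 1) ^ 2)) (Set.Ioo (1 - δ) (1 + δ)) :=
    ((integrable_exp_neg_mul_sq ht).comp_sub_right 1).integrableOn
  have h1 := lintegral_exp_neg_mul_sq_norm_sub ht (p : EuclideanSpace ℝ (Fin (d + 1)))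
  rw [lintegral_polar d (by fun_prop)] at h1
  have h2 : ENNReal.ofReal ((1 - δ) ^ d * sphereArea d * A *
      ∫ r in Set.Ioo (1 - δ) (1 + δ), Real.exp (-t * (r - 1) ^ 2)) ≤
      ENNReal.ofReal ((Real.pi / t) ^ (((d : ℝ) + 1) / 2)) := by
    have hfin : (((d : ℝ) + 1) / 2) =
        (Module.finrank ℝ (EuclideanSpace ℝ (Fin (d + 1))) / 2 : ℝ) := by simp
    rw [hfin, ← h1, ENNReal.ofReal_mul (by have : 0 < 1 - δ := by linarith
                                           positivity),
      ofReal_integral_eq_lintegral_ofReal hi (Eventually.of_forall fun _ ↦ (Real.exp_pos _).le),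
      ← lintegral_const_mul' _ _ ENNReal.ofReal_ne_top]
    refine (setLIntegral_mono_ae' measurableSet_Ioo (Eventually.of_forall fun r hr ↦ ?_)).trans
      (lintegral_mono_set fun r hr ↦ ?_)
    · have hr0 : 0 ≤ r := by linarith [hr.1]
      simp_rw [norm_smul_sub_sq_of_mem_sphere, mul_add, Real.exp_add,
        ENNReal.ofReal_mul (Real.exp_pos _).le]
      rw [lintegral_const_mul' _ _ ENNReal.ofReal_ne_top, surfaceMeasure_eq_smul,
        lintegral_smul_measure]
      simp_rw [← mul_assoc, neg_mul, ← neg_mul (t * r)]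
      rw [← ofReal_gaussianMean, smul_eq_mul, ← ENNReal.ofReal_mul (by positivity),
        ← ENNReal.ofReal_mul (by positivity), ← ENNReal.ofReal_mul hω.le,
        ← ENNReal.ofReal_mul (by positivity)]
      refine ENNReal.ofReal_le_ofReal ?_
      -- On the shell `r < 1 + δ`, and the mean decreases in its parameter.
      have hAr : A ≤ gaussianMean d p (t * r) :=
        gaussianMean_antitone p (by nlinarith [hr.2])
      have hpow : (1 - δ) ^ d ≤ r ^ d := pow_le_pow_left₀ (by linarith) hr.1.le d
      calc _ = (1 - δ) ^ d * Real.exp (-(t * (r - 1) ^ 2)) * (sphereArea d * A) := by ring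
        _ ≤ _ := by gcongr
    · exact lt_trans (by linarith) hr.1
  rw [ENNReal.ofReal_le_ofReal_iff (by positivity)] at h2
  have h3 := gaussian_interval_lower_bound ht hδ
  have hs : 0 < √(Real.pi / t) := by positivity
  have hsplit : (Real.pi / t) ^ (((d : ℝ) + 1) / 2) = (Real.pi / t) ^ ((d : ℝ) / 2) * √(Real.pi / t) := by
    rw [Real.sqrt_eq_rpow, ← Real.rpow_add (by positivity)]; congr 1; ring
  rw [hsplit] at h2
  have h1δ : 0 < 1 - δ := by linarith
  refine le_of_mul_le_mul_right ?_ hs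
  refine le_trans ?_ h2
  calc _ = (1 - δ) ^ d * sphereArea d * A *
        (√(Real.pi / t) * (1 - √2 * Real.exp (-(t * δ ^ 2 / 2)))) := by ring
    _ ≤ _ := by gcongr

open Topology in
/-- The potential of the uniform measure is asymptotically at most that of the tangent space. -/
lemma eventually_gaussianMean_le {d : ℕ} (p : UnitSphere d) {C : ℝ}
    (hC : Real.pi ^ ((d : ℝ) / 2) / sphereArea d < C) :
    ∀ᶠ t in atTop, gaussianMean d p t ≤ C * t ^ (-((d : ℝ) / 2)) := by
  have hω := sphereArea_pos d
  -- The strict inequality on `C` is the case `δ = 0`; continuity preserves it for small positive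
  -- `δ`.
  have hδ : ∃ δ : ℝ, 0 < δ ∧ δ < 1 ∧
      Real.pi ^ ((d : ℝ) / 2) * (1 + δ) ^ ((d : ℝ) / 2) < C * ((1 - δ) ^ d * sphereArea d) := by
    have hl : ContinuousAt (fun δ : ℝ ↦ C * ((1 - δ) ^ d * sphereArea d) -
        Real.pi ^ ((d : ℝ) / 2) * (1 + δ) ^ ((d : ℝ) / 2)) 0 := by
      refine ContinuousAt.sub (by fun_prop) (continuousAt_const.mul ?_)
      exact ContinuousAt.rpow_const (by fun_prop) (Or.inl (by norm_num))
    have h0 : 0 < C * ((1 - (0 : ℝ)) ^ d * sphereArea d) -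
        Real.pi ^ ((d : ℝ) / 2) * (1 + (0 : ℝ)) ^ ((d : ℝ) / 2) := by
      rw [div_lt_iff₀ hω] at hC
      simpa using hC
    have h1 : ∀ᶠ δ : ℝ in 𝓝[>] 0, δ < 1 := nhdsWithin_le_nhds (eventually_lt_nhds one_pos)
    have h2 : ∀ᶠ δ : ℝ in 𝓝[>] 0, 0 < C * ((1 - δ) ^ d * sphereArea d) -
        Real.pi ^ ((d : ℝ) / 2) * (1 + δ) ^ ((d : ℝ) / 2) :=
      nhdsWithin_le_nhds (hl.eventually_const_lt h0)
    obtain ⟨δ, h3, h4, h5⟩ := (h1.and (h2.and self_mem_nhdsWithin)).exists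
    exact ⟨δ, h5, h3, by linarith⟩
  obtain ⟨δ, hδ0, hδ1, hδC⟩ := hδ
  have hlim : Tendsto (fun t : ℝ ↦ C * ((1 - δ) ^ d * sphereArea d *
      (1 - √2 * Real.exp (-(t / (1 + δ) * δ ^ 2 / 2))))) atTop
      (𝓝 (C * ((1 - δ) ^ d * sphereArea d * (1 - √2 * 0)))) := by
    refine (((Tendsto.const_mul _ (Real.tendsto_exp_neg_atTop_nhds_zero.comp ?_)).const_sub
      1).const_mul _).const_mul _
    have : (fun t : ℝ ↦ t / (1 + δ) * δ ^ 2 / 2) = fun t ↦ (δ ^ 2 / (2 * (1 + δ))) * t := by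
      ext t; field_simp
    rw [this]
    exact tendsto_id.const_mul_atTop (by positivity)
  rw [mul_zero, sub_zero, mul_one] at hlim
  filter_upwards [hlim.eventually_const_lt hδC, eventually_gt_atTop 0] with t h1 ht
  have h1δ : 0 < 1 - δ := by linarith
  -- The bound is used at `t / (1 + δ)`, so that the mean is evaluated at `t` itself.
  have h2 := gaussianMean_upper_bound p (div_pos ht (by positivity : 0 < 1 + δ)) hδ0 hδ1
  rw [mul_div_cancel₀ _ (by positivity)] at h2
  have hpi : (Real.pi / (t / (1 + δ))) ^ ((d : ℝ) / 2) =
      Real.pi ^ ((d : ℝ) / 2) * (1 + δ) ^ ((d : ℝ) / 2) * t ^ (-((d : ℝ) / 2)) := by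
    rw [div_div_eq_mul_div, Real.div_rpow (by positivity) ht.le,
      Real.mul_rpow Real.pi_pos.le (by positivity), Real.rpow_neg ht.le, div_eq_mul_inv]
  rw [hpi] at h2
  set M := (1 - δ) ^ d * sphereArea d * (1 - √2 * Real.exp (-(t / (1 + δ) * δ ^ 2 / 2)))
  have hC0 : 0 < C := lt_of_le_of_lt (by positivity) hC
  have hM : 0 < M := by
    refine pos_of_mul_pos_right (a := C) (lt_of_le_of_lt ?_ h1) hC0.le
    positivity
  refine le_of_mul_le_mul_right (h2.trans ?_) hM
  calc _ ≤ C * M * t ^ (-((d : ℝ) / 2)) := by gcongr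
    _ = _ := by ring

/-! ### The deficit as an integral of Gaussian energy differences. -/

section Deficit

variable {α : ℝ} {d N : ℕ}

/-- This justifies Fubini: the integrand is nonnegative for `t > 0`, and its integral in `t` is a
multiple of `‖p - z‖ ^ α`, which is continuous on the compact sphere. -/
lemma integrable_gaussian_prod (hα0 : 0 < α) (hα2 : α < 2) (p : UnitSphere d) :
    Integrable (fun q : UnitSphere d × ℝ ↦
      (1 - Real.exp (-q.2 * ‖(p : EuclideanSpace ℝ (Fin (d + 1))) - q.1‖ ^ 2)) *
        q.2 ^ (-(α / 2) - 1)) ((uniformSphere d).prod (volume.restrict (Set.Ioi 0))) := by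
  have hm : Measurable fun q : UnitSphere d × ℝ ↦
      (1 - Real.exp (-q.2 * ‖(p : EuclideanSpace ℝ (Fin (d + 1))) - q.1‖ ^ 2)) *
        q.2 ^ (-(α / 2) - 1) := by fun_prop
  have h (z : UnitSphere d) : ∫ t in Set.Ioi (0 : ℝ),
      ‖(1 - Real.exp (-t * ‖(p : EuclideanSpace ℝ (Fin (d + 1))) - z‖ ^ 2)) *
        t ^ (-(α / 2) - 1)‖ = Real.Gamma (1 - α / 2) / (α / 2) *
          ‖(p : EuclideanSpace ℝ (Fin (d + 1))) - z‖ ^ α := by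
    generalize hr : ‖(p : EuclideanSpace ℝ (Fin (d + 1))) - z‖ = r
    have hr0 : 0 ≤ r := hr ▸ norm_nonneg _
    rw [← integral_one_sub_exp_mul_sq_mul_rpow hα0 hα2 hr0]
    refine setIntegral_congr_fun measurableSet_Ioi fun t (ht : 0 < t) ↦ ?_
    refine Real.norm_of_nonneg (mul_nonneg ?_ (Real.rpow_nonneg ht.le _))
    rw [sub_nonneg, Real.exp_le_one_iff]
    nlinarith [sq_nonneg r]
  rw [integrable_prod_iff hm.aestronglyMeasurable]
  refine ⟨Eventually.of_forall fun z ↦ ?_, ?_⟩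
  · exact integrableOn_one_sub_exp_mul_sq_mul_rpow hα0 hα2
      ‖(p : EuclideanSpace ℝ (Fin (d + 1))) - z‖
  simp only [h]
  exact integrable_of_continuous_unitSphere
    (continuous_const.mul (Continuous.rpow_const (by fun_prop) fun _ ↦ Or.inr hα0.le))

lemma integral_one_sub_gaussian (p : UnitSphere d) (t : ℝ) :
    ∫ z : UnitSphere d, (1 - Real.exp (-t * ‖(p : EuclideanSpace ℝ (Fin (d + 1))) - z‖ ^ 2)) *
      t ^ (-(α / 2) - 1) ∂(uniformSphere d) = (1 - gaussianMean d p t) * t ^ (-(α / 2) - 1) := by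
  rw [integral_mul_const, integral_sub (integrable_const _)
    (integrable_of_continuous_unitSphere (by fun_prop))]
  simp [gaussianMean]

lemma integrableOn_one_sub_gaussianMean (hα0 : 0 < α) (hα2 : α < 2) (p : UnitSphere d) :
    IntegrableOn (fun t ↦ (1 - gaussianMean d p t) * t ^ (-(α / 2) - 1)) (Set.Ioi 0) := by
  have h := (integrable_gaussian_prod hα0 hα2 p).integral_prod_right
  simp only [integral_one_sub_gaussian] at h
  exact h

lemma integral_dist_rpow (hα0 : 0 < α) (hα2 : α < 2) (p : UnitSphere d) :
    Real.Gamma (1 - α / 2) / (α / 2) *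
      ∫ y : UnitSphere d, ∫ z : UnitSphere d,
        ‖(y : EuclideanSpace ℝ (Fin (d + 1))) - z‖ ^ α ∂(uniformSphere d) ∂(uniformSphere d) =
      ∫ t in Set.Ioi (0 : ℝ), (1 - gaussianMean d p t) * t ^ (-(α / 2) - 1) := by
  have hconst (y : UnitSphere d) := integral_radial_eq (F := fun r ↦ r ^ α)
    (Real.continuous_rpow_const hα0.le) y p
  simp only [hconst, integral_const, probReal_univ, one_smul]
  rw [← integral_const_mul]
  simp_rw [← integral_one_sub_exp_mul_sq_mul_rpow hα0 hα2 (norm_nonneg _)]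
  rw [integral_integral_swap (integrable_gaussian_prod hα0 hα2 p)]
  simp_rw [integral_one_sub_gaussian]

lemma one_sub_gaussianEnergy (hN : N ≠ 0) (x : Fin N → UnitSphere d) (t : ℝ) :
    (1 - gaussianEnergy x t) * t ^ (-(α / 2) - 1) = 1 / (N : ℝ) ^ 2 * ∑ j, ∑ k,
      (1 - Real.exp (-t * ‖(x j : EuclideanSpace ℝ (Fin (d + 1))) - x k‖ ^ 2)) *
        t ^ (-(α / 2) - 1) := by
  simp only [gaussianEnergy, ← Finset.sum_mul, Finset.sum_sub_distrib, Finset.sum_const,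
    Finset.card_univ, Fintype.card_fin, nsmul_eq_mul, mul_one]
  have : (N : ℝ) ≠ 0 := by exact_mod_cast hN
  field_simp

lemma integrableOn_one_sub_gaussianEnergy (hα0 : 0 < α) (hα2 : α < 2) (hN : N ≠ 0)
    (x : Fin N → UnitSphere d) :
    IntegrableOn (fun t ↦ (1 - gaussianEnergy x t) * t ^ (-(α / 2) - 1)) (Set.Ioi 0) := by
  simp_rw [one_sub_gaussianEnergy hN]
  exact (integrable_finsetSum _ fun j _ ↦ integrable_finsetSum _ fun k _ ↦
    integrableOn_one_sub_exp_mul_sq_mul_rpow hα0 hα2 _).const_mul _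

lemma sum_dist_rpow (hα0 : 0 < α) (hα2 : α < 2) (hN : N ≠ 0) (x : Fin N → UnitSphere d) :
    Real.Gamma (1 - α / 2) / (α / 2) * (1 / (N : ℝ) ^ 2 * ∑ j, ∑ k,
      ‖(x j : EuclideanSpace ℝ (Fin (d + 1))) - x k‖ ^ α) =
      ∫ t in Set.Ioi (0 : ℝ), (1 - gaussianEnergy x t) * t ^ (-(α / 2) - 1) := by
  have hi (j k : Fin N) := integrableOn_one_sub_exp_mul_sq_mul_rpow hα0 hα2
    ‖(x j : EuclideanSpace ℝ (Fin (d + 1))) - x k‖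
  simp_rw [one_sub_gaussianEnergy hN]
  rw [integral_const_mul, integral_finsetSum _ fun j _ ↦ integrable_finsetSum _ fun k _ ↦ hi j k]
  simp_rw [integral_finsetSum _ fun k _ ↦ hi _ k,
    integral_one_sub_exp_mul_sq_mul_rpow hα0 hα2 (norm_nonneg _), ← Finset.mul_sum]
  ring

lemma integrableOn_gaussianEnergy_sub_gaussianMean (hα0 : 0 < α) (hα2 : α < 2) (hN : N ≠ 0)
    (x : Fin N → UnitSphere d) (p : UnitSphere d) :
    IntegrableOn (fun t ↦ (gaussianEnergy x t - gaussianMean d p t) * t ^ (-(α / 2) - 1))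
      (Set.Ioi 0) :=
  ((integrableOn_one_sub_gaussianMean hα0 hα2 p).sub
    (integrableOn_one_sub_gaussianEnergy hα0 hα2 hN x)).congr
    (Eventually.of_forall fun t ↦ by simp only [Pi.sub_apply]; ring)

/-- The deficit as a superposition of Gaussian energy differences. -/
lemma distPowerDeficit_eq (hα0 : 0 < α) (hα2 : α < 2) (hN : N ≠ 0)
    (x : Fin N → UnitSphere d) (p : UnitSphere d) :
    Real.Gamma (1 - α / 2) / (α / 2) * distPowerDeficit α x =
      ∫ t in Set.Ioi (0 : ℝ),
        (gaussianEnergy x t - gaussianMean d p t) * t ^ (-(α / 2) - 1) := by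
  rw [distPowerDeficit, mul_sub, integral_dist_rpow hα0 hα2 p, sum_dist_rpow hα0 hα2 hN,
    ← integral_sub (integrableOn_one_sub_gaussianMean hα0 hα2 p)
    (integrableOn_one_sub_gaussianEnergy hα0 hα2 hN x)]
  congr 1 with t
  ring

/-- The lower limit `s` is the zero of `n - C t^(-b)`, so both terms integrate to multiples of `n
s^(-a)`, and `1/a - 1/(a + b) = b / (a (a + b))`. -/
lemma integral_sub_rpow_mul_rpow {a b n C s : ℝ} (ha : 0 < a) (hb : 0 < b) (hs : 0 < s)
    (hsC : C * s ^ (-b) = n) :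
    ∫ t in Set.Ioi s, (n - C * t ^ (-b)) * t ^ (-a - 1) = n * s ^ (-a) * (b / (a * (a + b))) := by
  have h1 := integrableOn_Ioi_rpow_of_lt (by linarith : -a - 1 < -1) hs
  have h2 := integrableOn_Ioi_rpow_of_lt (by linarith : -b + (-a - 1) < -1) hs
  have hcongr : ∀ t ∈ Set.Ioi s, (n - C * t ^ (-b)) * t ^ (-a - 1) =
      n * t ^ (-a - 1) - C * t ^ (-b + (-a - 1)) := fun t ht ↦ by
    rw [Real.rpow_add (hs.trans ht)]; ring
  rw [setIntegral_congr_fun measurableSet_Ioi hcongr,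
    integral_sub (h1.const_mul _) (h2.const_mul _), integral_const_mul, integral_const_mul,
    integral_Ioi_rpow_of_lt (by linarith) hs, integral_Ioi_rpow_of_lt (by linarith) hs,
    show -a - 1 + 1 = -a by ring, show -b + (-a - 1) + 1 = -b + -a by ring, Real.rpow_add hs,
    ← hsC]
  have : a + b ≠ 0 := by positivity
  have h' : -b + -a ≠ 0 := by intro h; apply this; linarith
  field_simp
  ring

/-- Lower bound for the deficit in terms of an upper bound for the Gaussian potential. -/
lemma distPowerDeficit_lower_bound (hd : 0 < d) (hα0 : 0 < α) (hα2 : α < 2) (hN : N ≠ 0)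
    (x : Fin N → UnitSphere d) (p : UnitSphere d) {C : ℝ} (hC : 0 < C)
    (hpC : ∀ t ≥ (C * N) ^ (2 / (d : ℝ)), gaussianMean d p t ≤ C * t ^ (-((d : ℝ) / 2))) :
    C ^ (-(α / d)) * (1 / Real.Gamma (1 - α / 2)) * (1 / (1 + α / d)) ≤
      (N : ℝ) ^ (1 + α / d) * distPowerDeficit α x := by
  have hN0 : (0 : ℝ) < N := by positivity
  have hd0 : (0 : ℝ) < d := by positivity
  have hG : 0 < Real.Gamma (1 - α / 2) := Real.Gamma_pos_of_pos (by linarith)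
  set s := (C * N) ^ (2 / (d : ℝ)) with hs_def
  have hs : 0 < s := by positivity
  have hsC : C * s ^ (-((d : ℝ) / 2)) = 1 / N := by
    rw [hs_def, ← Real.rpow_mul (by positivity),
      show 2 / (d : ℝ) * -((d : ℝ) / 2) = -1 by field_simp, Real.rpow_neg_one]
    field_simp
  have hi := integrableOn_gaussianEnergy_sub_gaussianMean hα0 hα2 hN x p
  have hint := integral_sub_rpow_mul_rpow (a := α / 2) (b := d / 2) (by positivity) (by positivity)
    hs hsC
  have hil : IntegrableOn (fun t ↦ (1 / N - C * t ^ (-((d : ℝ) / 2))) * t ^ (-(α / 2) - 1))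
      (Set.Ioi s) := by
    by_contra h
    rw [integral_undef h] at hint
    exact (by positivity :
      0 < 1 / (N : ℝ) * s ^ (-(α / 2)) * (d / 2 / (α / 2 * (α / 2 + d / 2)))).ne hint
  have hle : 1 / (N : ℝ) * s ^ (-(α / 2)) * (d / 2 / (α / 2 * (α / 2 + d / 2))) ≤
      Real.Gamma (1 - α / 2) / (α / 2) * distPowerDeficit α x := by
    rw [distPowerDeficit_eq hα0 hα2 hN x p, ← hint]
    have hsub : Set.Ioi s ⊆ Set.Ioi 0 := Set.Ioi_subset_Ioi hs.le
    -- Beyond `s` the diagonal bound on the energy is used; the part of the integral up to `s` is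
    -- dropped, being nonnegative by positive definiteness.
    refine (setIntegral_mono_on hil (hi.mono_set hsub) measurableSet_Ioi fun t ht ↦ ?_).trans
      (setIntegral_mono_set hi ?_ (LE.le.eventuallyLE hsub))
    · have := inv_le_gaussianEnergy x t
      have := hpC t (le_of_lt ht)
      have : 0 < t ^ (-(α / 2) - 1) := Real.rpow_pos_of_pos (hs.trans ht) _
      gcongr
    · filter_upwards [ae_restrict_mem measurableSet_Ioi] with t ht
      exact mul_nonneg (sub_nonneg.2 (gaussianMean_le_gaussianEnergy hN x p ht))
        (Real.rpow_nonneg (le_of_lt ht) _)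
  have hsα : s ^ (-(α / 2)) = C ^ (-(α / d)) * (N : ℝ) ^ (-(α / d)) := by
    rw [hs_def, ← Real.rpow_mul (by positivity), ← Real.mul_rpow hC.le hN0.le]
    congr 1
    field_simp
  rw [hsα] at hle
  have hNα : (N : ℝ) ^ (-(α / d)) * (N : ℝ) ^ (1 + α / d) = N := by
    rw [← Real.rpow_add hN0]; simp
  have hP : 0 < (N : ℝ) ^ (1 + α / d) := by positivity
  have hκ : 0 < Real.Gamma (1 - α / 2) / (α / 2) := by positivity
  refine le_of_mul_le_mul_left ?_ hκ
  calc _ = (N : ℝ) ^ (1 + α / d) * (1 / (N : ℝ) * (C ^ (-(α / d)) * (N : ℝ) ^ (-(α / d))) *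
        (d / 2 / (α / 2 * (α / 2 + d / 2)))) := by
        rw [show (N : ℝ) ^ (1 + α / d) * (1 / (N : ℝ) * (C ^ (-(α / d)) * (N : ℝ) ^ (-(α / d))) *
          (d / 2 / (α / 2 * (α / 2 + d / 2)))) = ((N : ℝ) ^ (-(α / d)) * (N : ℝ) ^ (1 + α / d)) *
          (1 / N * C ^ (-(α / d)) * (d / 2 / (α / 2 * (α / 2 + d / 2)))) by ring, hNα]
        generalize Real.Gamma (1 - α / 2) = G at hG
        field_simp
        ring
    _ ≤ (N : ℝ) ^ (1 + α / d) * (Real.Gamma (1 - α / 2) / (α / 2) * distPowerDeficit α x) := by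
        gcongr
    _ = _ := by ring

end Deficit

/-! ### The constant and the passage to the limit. -/

lemma asympConst_eq {d : ℕ} (hd : 0 < d) (α : ℝ) :
    asympConst α d = sphereArea d ^ (α / (d : ℝ)) * (1 / Real.Gamma (1 - α / 2)) *
      (1 / (1 + α / (d : ℝ))) * (1 / Real.pi ^ (α / 2)) := by
  have hd0 : (0 : ℝ) < d := by positivity
  have hpi := Real.pi_pos
  have hG : 0 < Real.Gamma (((d : ℝ) + 1) / 2) := Real.Gamma_pos_of_pos (by positivity)
  have harea : sphereArea d = 2 * Real.Gamma (1 / 2) / Real.Gamma (((d : ℝ) + 1) / 2) *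
      Real.pi ^ ((d : ℝ) / 2) := by
    rw [sphereArea_eq, Real.Gamma_one_half_eq, Real.sqrt_eq_rpow,
      show ((d : ℝ) + 1) / 2 = 1 / 2 + d / 2 by ring, Real.rpow_add hpi]
    ring
  have hG2 : 0 < Real.Gamma (1 / 2) := Real.Gamma_pos_of_pos (by norm_num)
  rw [harea, Real.mul_rpow (by positivity) (by positivity), ← Real.rpow_mul hpi.le,
    show (d : ℝ) / 2 * (α / d) = α / 2 by field_simp, asympConst]
  have : Real.pi ^ (α / 2) ≠ 0 := by positivity
  field_simp

/-- This exhibits the constant as the bound of `distPowerDeficit_lower_bound` at the critical `C =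
π^(d/2) / ω_d`. -/
lemma asympConst_eq_rpow {d : ℕ} (hd : 0 < d) (α : ℝ) :
    asympConst α d = (Real.pi ^ ((d : ℝ) / 2) / sphereArea d) ^ (-(α / d)) *
      (1 / Real.Gamma (1 - α / 2)) * (1 / (1 + α / d)) := by
  have hd0 : (0 : ℝ) < d := by positivity
  have hpi := Real.pi_pos
  have hω := sphereArea_pos d
  rw [asympConst_eq hd, Real.rpow_neg (by positivity), Real.div_rpow (by positivity) hω.le,
    ← Real.rpow_mul hpi.le, show (d : ℝ) / 2 * (α / d) = α / 2 by field_simp, inv_div]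
  ring

theorem mainTheorem8 (d : ℕ) (hd : 2 ≤ d) (α : ℝ) (hα0 : 0 < α) (hα2 : α < 2) :
    ((asympConst α d : ℝ) : EReal) ≤
        liminf (fun N : ℕ => ⨅ x : Fin N → UnitSphere d,
          (((N : ℝ) ^ (1 + α / (d : ℝ)) * distPowerDeficit α x : ℝ) : EReal)) atTop ∧
      asympConst α d =
        sphereArea d ^ (α / (d : ℝ)) * (1 / Real.Gamma (1 - α / 2)) *
          (1 / (1 + α / (d : ℝ))) * (1 / Real.pi ^ (α / 2)) := by
  have hd0 : 0 < d := by omega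
  refine ⟨?_, asympConst_eq hd0 α⟩
  have hdR : (0 : ℝ) < d := by positivity
  have hω := sphereArea_pos d
  obtain ⟨p⟩ : Nonempty (UnitSphere d) :=
    (NormedSpace.sphere_nonempty.2 zero_le_one).to_subtype
  set C₀ := Real.pi ^ ((d : ℝ) / 2) / sphereArea d with hC₀
  have hC₀pos : 0 < C₀ := by positivity
  have hbound : ∀ C > C₀,
      ((C ^ (-(α / d)) * (1 / Real.Gamma (1 - α / 2)) * (1 / (1 + α / d)) : ℝ) : EReal) ≤
        liminf (fun N : ℕ => ⨅ x : Fin N → UnitSphere d,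
          (((N : ℝ) ^ (1 + α / (d : ℝ)) * distPowerDeficit α x : ℝ) : EReal)) atTop := by
    intro C hC
    have hCpos : 0 < C := hC₀pos.trans hC
    obtain ⟨T, hT⟩ := eventually_atTop.1 (eventually_gaussianMean_le p hC)
    -- The threshold depends on `N` but not on the configuration, so for large `N` the estimate
    -- holds uniformly in `x`.
    have hlim : Tendsto (fun N : ℕ ↦ (C * N) ^ (2 / (d : ℝ))) atTop atTop :=
      (tendsto_rpow_atTop (by positivity)).comp
        (tendsto_natCast_atTop_atTop.const_mul_atTop hCpos)
    refine le_liminf_of_le (by isBoundedDefault) ?_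
    filter_upwards [hlim.eventually_ge_atTop T, eventually_ne_atTop 0] with N hN hN0
    exact le_iInf fun x ↦ EReal.coe_le_coe_iff.2 (distPowerDeficit_lower_bound hd0 hα0 hα2 hN0 x p
      hCpos fun t ht ↦ hT t (hN.trans ht))
  have hcont : Tendsto (fun C : ℝ ↦ ((C ^ (-(α / d)) * (1 / Real.Gamma (1 - α / 2)) *
      (1 / (1 + α / d)) : ℝ) : EReal)) (nhdsWithin C₀ (Set.Ioi C₀))
      (nhds ((asympConst α d : ℝ) : EReal)) := by
    rw [asympConst_eq_rpow hd0]
    refine (continuous_coe_real_ereal.tendsto _).comp ?_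
    exact (((Real.continuousAt_rpow_const C₀ _ (Or.inl hC₀pos.ne')).tendsto.mul_const _).mul_const
      _).mono_left nhdsWithin_le_nhds
  -- The bound is available only for `C > C₀`, hence the one-sided limit.
  exact le_of_tendsto hcont (eventually_nhdsWithin_of_forall hbound)
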